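/- Let $X=\mathbb H/\Gamma$ be a complete oriented hyperbolic surface, with $\Gamma$ a torsion-free Fuchsian group, and let $L(\cdot)$ denote hyperbolic length. Let $\alpha\subset X$ be a simple closed geodesic, and let $0<r\le\infty$ be such that $A=B(\alpha,r)=\{x\in X : d(x,\alpha)<r\}$ is a collar, i.e. an embedded annulus: the normal exponential map of $\alpha$ is a bijection from $\alpha\times(-r,r)$ onto $A$. An arc crossing $A$ is a geodesic arc $\gamma\subset A$ (without its endpoints) joining the two boundary components of $A$; that is, the signed distance to $\alpha$ tends to $-r$ at one end of $\gamma$ and to $r$ at the other. (For $r=\infty$ we have $A=X$ and $\gamma$ is a complete geodesic crossing $\alpha$.) Direct $\alpha$, and direct $\gamma$ so that it runs from the right of $\alpha$ to the left. Lift the nearest-point projection of $\gamma$ to $\alpha\cong\mathbb R/L(\alpha)\mathbb Z$ continuously to $\mathbb R$, and let $a$ and $b$ be its limits at the beginning and at the end of $\gamma$. The winding number of $\gamma$ is $w(\gamma,\alpha)=(b-a)/L(\alpha)\in\mathbb R$. **Theorem.** 1. For every arc $\gamma$ crossing a collar $B(\alpha,r)$, the limits $a,b$ exist, and $w(\gamma,\alpha)$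 does not depend on the choice of the lift. 2. There is an absolute constant $C$ such that for every arc $\gamma$ crossing a collar $B(\alpha,r)$ with $r<\infty$, the length $L(\gamma)$ is finite and $$\bigl|\,L(\gamma)-\bigl(2r+|w(\gamma,\alpha)|\,L(\alpha)\bigr)\bigr|\le C .$$ 3. For any two distinct arcs $\gamma\ne\gamma'$ crossing the same collar $B(\alpha,r)$, $0<r\le\infty$, the set $\gamma\cap\gamma'$ is finite and $$|\gamma\cap\gamma'|=|w(\gamma,\alpha)-w(\gamma',\alpha)|+E,\qquad |E|\le 1 .$$ -/

import Mathlib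

open Set Filter Topology

namespace HypSurf

noncomputable section

/-- Orientation-preserving isometries of the upper half-plane, acting by Möbius transformations.
An element also serves as an oriented orthonormal frame, i.e. as a unit tangent vector. -/
abbrev SL2R : Type := Matrix.SpecialLinearGroup (Fin 2) ℝ

/-- `Γ` is a torsion-free Fuchsian group: it is discrete, and the induced group of isometries acts
freely on the upper half-plane (`-1 ∈ Γ` is allowed, it acts trivially). -/
structure IsSurfaceGroup (Γ : Subgroup SL2R) : Prop where
  discrete : DiscreteTopology Γ
  free : ∀ g ∈ Γ, ∀ z : UpperHalfPlane, g • z = z → g = 1 ∨ g = -1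

/-- The complete oriented hyperbolic surface `ℍ / Γ`. -/
abbrev Surface (Γ : Subgroup SL2R) : Type := MulAction.orbitRel.Quotient Γ UpperHalfPlane

/-- The universal covering `ℍ → ℍ / Γ`. -/
def proj (Γ : Subgroup SL2R) (z : UpperHalfPlane) : Surface Γ :=
  Quotient.mk (MulAction.orbitRel Γ UpperHalfPlane) z

/-- The hyperbolic distance on `ℍ / Γ`: the infimum of the distances between lifts. -/
def surfaceDist (Γ : Subgroup SL2R) (x y : Surface Γ) : ℝ :=
  sInf {d : ℝ | ∃ z w : UpperHalfPlane, proj Γ z = x ∧ proj Γ w = y ∧ d = dist z w}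

/-- The point `exp s * (-tanh ρ + i / cosh ρ)`, in normal (Fermi) coordinates along the imaginary
axis: its nearest point on the axis is `i * exp s`, and its signed distance to the axis is `ρ`,
positive on the left of the axis (directed upwards).  Its logarithm, in the strip
`0 < Im < π`, has real part `s`. -/
def stdFermi (s ρ : ℝ) : UpperHalfPlane :=
  ⟨⟨-(Real.exp s * Real.tanh ρ), Real.exp s / Real.cosh ρ⟩,
    div_pos (Real.exp_pos s) (Real.cosh_pos ρ)⟩

/-- Normal coordinates along the geodesic line determined by the frame `g`. -/
def fermi (g : SL2R) (s ρ : ℝ) : UpperHalfPlane := g • stdFermi s ρ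

/-- The unit-speed complete geodesic `t ↦ g • (i * exp t)` of the upper half-plane; every
unit-speed complete geodesic is of this form. -/
def line (g : SL2R) (t : ℝ) : UpperHalfPlane := fermi g t 0

/-- A simple closed geodesic on `ℍ / Γ`: the unit-speed geodesic `s ↦ proj (line frame s)`,
which closes up after time `length` and is injective on a period. -/
structure SimpleClosedGeodesic (Γ : Subgroup SL2R) where
  frame : SL2R
  length : ℝ
  length_pos : 0 < length
  proj_eq_iff : ∀ s s' : ℝ,
    proj Γ (line frame s) = proj Γ (line frame s') ↔ ∃ n : ℤ, s' = s + n * length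

namespace SimpleClosedGeodesic

variable {Γ : Subgroup SL2R}

/-- The point set of a simple closed geodesic. -/
def carrier (α : SimpleClosedGeodesic Γ) : Set (Surface Γ) :=
  range fun s : ℝ => proj Γ (line α.frame s)

/-- The normal exponential map of `α`: `α.normal s ρ` is the point at signed distance `ρ` from
`α(s)` on the geodesic orthogonal to `α` at `α(s)`. -/
def normal (α : SimpleClosedGeodesic Γ) (s ρ : ℝ) : Surface Γ := proj Γ (fermi α.frame s ρ)

/-- `B(α, r)`, the points at distance less than `r` from `α`; `r = ⊤` is allowed. -/
def nbhd (α : SimpleClosedGeodesic Γ) (r : EReal) : Set (Surface Γ) :=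
  {x | ∃ p ∈ α.carrier, (surfaceDist Γ x p : EReal) < r}

/-- `B(α, r)` is a collar, i.e. an embedded annulus: the normal exponential map is a bijection
from `(ℝ / length ℤ) × (-r, r)` onto `B(α, r)`. -/
structure IsCollar (α : SimpleClosedGeodesic Γ) (r : EReal) : Prop where
  pos : 0 < r
  image_eq : {x | ∃ s ρ : ℝ, ((|ρ| : ℝ) : EReal) < r ∧ α.normal s ρ = x} = α.nbhd r
  inj : ∀ s ρ s' ρ' : ℝ, ((|ρ| : ℝ) : EReal) < r → ((|ρ'| : ℝ) : EReal) < r →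
    α.normal s ρ = α.normal s' ρ' → ρ = ρ' ∧ ∃ n : ℤ, s' = s + n * α.length

end SimpleClosedGeodesic

/-- A geodesic arc on `ℍ / Γ`, without its endpoints: the image of the unit-speed geodesic
`line frame`, restricted to the nonempty open interval `lo < t < hi`. -/
structure GeodesicArc (Γ : Subgroup SL2R) where
  frame : SL2R
  lo : EReal
  hi : EReal
  lo_lt_hi : lo < hi

namespace GeodesicArc

variable {Γ : Subgroup SL2R}

/-- The parameter interval. -/
def dom (γ : GeodesicArc Γ) : Set ℝ := {t | γ.lo < (t : EReal) ∧ (t : EReal) < γ.hi}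

/-- The unit-speed parametrization on the surface. -/
def curve (γ : GeodesicArc Γ) (t : ℝ) : Surface Γ := proj Γ (line γ.frame t)

/-- The point set of the arc. -/
def carrier (γ : GeodesicArc Γ) : Set (Surface Γ) := γ.curve '' γ.dom

/-- The length of the arc (possibly infinite). -/
def length (γ : GeodesicArc Γ) : EReal := γ.hi - γ.lo

/-- `t ↓ lo` (that is, `t → -∞` if `lo = ⊥`). -/
def atLo (γ : GeodesicArc Γ) : Filter ℝ := comap (fun t : ℝ => (t : EReal)) (𝓝[>] γ.lo)

/-- `t ↑ hi` (that is, `t → ∞` if `hi = ⊤`). -/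
def atHi (γ : GeodesicArc Γ) : Filter ℝ := comap (fun t : ℝ => (t : EReal)) (𝓝[<] γ.hi)

/-- The arc lies in `B(α, r)` and joins the boundary component on the right of `α` to the one on
the left; `(s, ρ)` are its normal coordinates, so that `s` is a continuous lift to `ℝ` of the
nearest-point projection of the arc to `α = ℝ / length ℤ`, and `ρ` is the signed distance to `α`.
An unoriented arc joining the two boundary components has exactly one such direction. -/
structure IsCrossing (γ : GeodesicArc Γ) (α : SimpleClosedGeodesic Γ) (r : EReal)
    (s ρ : ℝ → ℝ) : Prop where
  continuousOn_s : ContinuousOn s γ.dom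
  continuousOn_ρ : ContinuousOn ρ γ.dom
  curve_eq : ∀ t ∈ γ.dom, γ.curve t = α.normal (s t) (ρ t)
  abs_lt : ∀ t ∈ γ.dom, ((|ρ t| : ℝ) : EReal) < r
  tendsto_lo : Tendsto (fun t => (ρ t : EReal)) γ.atLo (𝓝 (-r))
  tendsto_hi : Tendsto (fun t => (ρ t : EReal)) γ.atHi (𝓝 r)

/-- The arc joins the two boundary components of `B(α, r)` inside `B(α, r)`. -/
def Crosses (γ : GeodesicArc Γ) (α : SimpleClosedGeodesic Γ) (r : EReal) : Prop :=
  ∃ s ρ : ℝ → ℝ, γ.IsCrossing α r s ρ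

/-- `w` is the geometric winding number of the crossing arc: `w = (b - a) / L(α)`, where the
lifted nearest-point projection to `α` runs from `a` (right end) to `b` (left end). -/
def HasWinding (γ : GeodesicArc Γ) (α : SimpleClosedGeodesic Γ) (r : EReal) (w : ℝ) : Prop :=
  ∃ s ρ : ℝ → ℝ, γ.IsCrossing α r s ρ ∧
    ∃ a b : ℝ, Tendsto s γ.atLo (𝓝 a) ∧ Tendsto s γ.atHi (𝓝 b) ∧ w = (b - a) / α.length

end GeodesicArc

end

end HypSurf

open HypSurf

namespace HypSurf

/-! ### Hyperbolic tangent -/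

/-! Develop a crossing arc into ℍ so that the lift of `α` becomes the imaginary axis. In the
coordinates `(s, u)` with `u = tanh ρ`, every geodesic with points on both sides of the axis is a
graph `s = s₀ + arsinh (c * u)` (`exists_graph`), and the collar is the strip `|u| < U`, with `U =
1` for infinite width.

The three claims are read off from this graph. The limits are `s₀ ∓ arsinh (c * U)`, so the winding
number is `2 * arsinh (c * U) / L`, where `L` is the length of `α`; two lifts differ by a constant
multiple of `L`, which cancels in `b - a`. For finite `r` the length satisfies `cosh ℓ = cosh² r *
cosh (b - a) + sinh² r`, which is comparable with `exp (2r + |b - a|)`.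

Two arcs meet exactly at those `u` where their `s`-coordinates differ by a multiple of `L`. For `c <
c'` the difference of the graphs is strictly increasing in `u` (`strictMono_arsinh_sub`), so
intersections correspond to the integers in an open interval of length `|w - w'|`
(`ncard_int_values`). -/

theorem tanh_strictMono : StrictMono Real.tanh := by
  intro x y h
  have hx : Real.tanh x ∈ Ioo (-1 : ℝ) 1 := ⟨Real.neg_one_lt_tanh x, Real.tanh_lt_one x⟩
  have hy : Real.tanh y ∈ Ioo (-1 : ℝ) 1 := ⟨Real.neg_one_lt_tanh y, Real.tanh_lt_one y⟩
  rwa [← Real.artanh_lt_artanh_iff hx hy, Real.artanh_tanh, Real.artanh_tanh]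

theorem continuous_tanh : Continuous Real.tanh := by
  have : Real.tanh = fun x => Real.sinh x / Real.cosh x := funext Real.tanh_eq_sinh_div_cosh
  rw [this]
  exact Real.continuous_sinh.div Real.continuous_cosh fun x => (Real.cosh_pos x).ne'

theorem tendsto_tanh_atTop : Tendsto Real.tanh atTop (𝓝 1) := by
  refine tendsto_order.2 ⟨fun u hu => ?_, fun u hu => ?_⟩
  · rcases le_or_gt u (-1) with h | h
    · exact Eventually.of_forall fun x => h.trans_lt (Real.neg_one_lt_tanh x)
    · filter_upwards [eventually_gt_atTop (Real.artanh u)] with x hx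
      rw [← Real.tanh_artanh ⟨h, hu⟩]
      exact tanh_strictMono hx
  · exact Eventually.of_forall fun x => (Real.tanh_lt_one x).trans hu

theorem abs_tanh (x : ℝ) : |Real.tanh x| = Real.tanh |x| := by
  rcases le_total 0 x with h | h
  · have : 0 ≤ Real.tanh x := by simpa using tanh_strictMono.monotone h
    rw [abs_of_nonneg h, abs_of_nonneg this]
  · have : Real.tanh x ≤ 0 := by simpa using tanh_strictMono.monotone h
    rw [abs_of_nonpos h, abs_of_nonpos this, Real.tanh_neg]

/-- `tanh` carries the interval `(-r, r)` of normal coordinates to `(-U, U)`; here `U = 1` if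
`r = ⊤`. -/
theorem exists_tanh_width {r : EReal} (hr : 0 < r) :
    ∃ U : ℝ, 0 < U ∧ U ≤ 1 ∧ (∀ x : ℝ, ((|x| : ℝ) : EReal) < r ↔ |Real.tanh x| < U) ∧
      ∀ {l : Filter ℝ} {f : ℝ → ℝ}, Tendsto (fun t => (f t : EReal)) l (𝓝 r) →
        Tendsto (fun t => Real.tanh (f t)) l (𝓝 U) := by
  induction r with
  | bot => simp at hr
  | coe r =>
    refine ⟨Real.tanh r, ?_, (Real.tanh_lt_one r).le, fun x => ?_, fun {l f} h => ?_⟩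
    · simpa using tanh_strictMono (EReal.coe_pos.1 hr)
    · rw [abs_tanh, tanh_strictMono.lt_iff_lt, EReal.coe_lt_coe_iff]
    · exact (continuous_tanh.tendsto r).comp (EReal.tendsto_coe.1 h)
  | top =>
    refine ⟨1, one_pos, le_rfl, fun x => ?_, fun {l f} h => ?_⟩
    · simp [EReal.coe_lt_top, Real.abs_tanh_lt_one]
    · exact tendsto_tanh_atTop.comp (EReal.tendsto_coe_nhds_top_iff.1 h)

/-! ### Fermi coordinates -/

theorem stdFermi_re (s ρ : ℝ) : (stdFermi s ρ).re = -(Real.exp s * Real.tanh ρ) := rfl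

theorem stdFermi_im (s ρ : ℝ) : (stdFermi s ρ).im = Real.exp s / Real.cosh ρ := rfl

theorem continuous_stdFermi : Continuous fun p : ℝ × ℝ => stdFermi p.1 p.2 := by
  rw [UpperHalfPlane.isEmbedding_coe.continuous_iff]
  have : (UpperHalfPlane.coe ∘ fun p : ℝ × ℝ => stdFermi p.1 p.2) = fun p : ℝ × ℝ =>
      ((-(Real.exp p.1 * Real.tanh p.2) : ℝ) : ℂ) +
        ((Real.exp p.1 / Real.cosh p.2 : ℝ) : ℂ) * Complex.I := by
    ext p
    apply Complex.ext
    · simp only [Complex.add_re, Complex.re_ofReal_mul, Complex.ofReal_re, Complex.I_re, mul_zero,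
        add_zero]
      rfl
    · simp only [Complex.add_im, Complex.im_ofReal_mul, Complex.ofReal_im, Complex.I_im, mul_one,
        zero_add]
      rfl
  rw [this]
  have h1 : Continuous fun p : ℝ × ℝ => Real.tanh p.2 := continuous_tanh.comp continuous_snd
  have h2 : Continuous fun p : ℝ × ℝ => Real.exp p.1 / Real.cosh p.2 :=
    (Real.continuous_exp.comp continuous_fst).div (Real.continuous_cosh.comp continuous_snd)
      fun p => (Real.cosh_pos p.2).ne'
  fun_prop

theorem cosh_dist_stdFermi (s ρ s' ρ' : ℝ) :
    Real.cosh (dist (stdFermi s ρ) (stdFermi s' ρ')) =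
      Real.cosh ρ * Real.cosh ρ' * Real.cosh (s - s') - Real.sinh ρ * Real.sinh ρ' := by
  rw [UpperHalfPlane.cosh_dist', stdFermi_re, stdFermi_re, stdFermi_im, stdFermi_im,
    Real.tanh_eq_sinh_div_cosh, Real.tanh_eq_sinh_div_cosh, Real.cosh_eq (s - s'),
    neg_sub, Real.exp_sub, Real.exp_sub]
  have h := Real.cosh_sq ρ
  have h' := Real.cosh_sq ρ'
  have hc := Real.cosh_pos ρ
  have hc' := Real.cosh_pos ρ'
  have he := Real.exp_pos s
  have he' := Real.exp_pos s'
  generalize Real.exp s = x at *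
  generalize Real.exp s' = y at *
  generalize Real.cosh ρ = p at *
  generalize Real.cosh ρ' = q at *
  field_simp
  linear_combination (-x ^ 2 * q ^ 2) * h + (-y ^ 2 * p ^ 2) * h'

theorem cosh_dist_line (g : SL2R) (t t' : ℝ) :
    Real.cosh (dist (line g t) (line g t')) = Real.cosh (t - t') := by
  rw [line, line, fermi, fermi, dist_smul, cosh_dist_stdFermi]
  simp

/-- Real part and squared modulus of the Möbius image of `i * exp t`, cleared of the denominator `|c
* i * exp t + d|²`. The angular factor drops out of the modulus because `|stdFermi s ρ| = exp s`. -/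
theorem line_coords {k : SL2R} {t s ρ : ℝ} (h : line k t = stdFermi s ρ) :
    0 < (k 1 0) ^ 2 * Real.exp t ^ 2 + (k 1 1) ^ 2 ∧
    ((k 1 0) ^ 2 * Real.exp t ^ 2 + (k 1 1) ^ 2) * (Real.exp s * Real.tanh ρ) =
      -(k 0 0 * k 1 0 * Real.exp t ^ 2 + k 0 1 * k 1 1) ∧
    ((k 1 0) ^ 2 * Real.exp t ^ 2 + (k 1 1) ^ 2) * Real.exp s ^ 2 =
      (k 0 0) ^ 2 * Real.exp t ^ 2 + (k 0 1) ^ 2 := by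
  have hdet : k 0 0 * k 1 1 - k 0 1 * k 1 0 = 1 := by
    rw [← Matrix.det_fin_two, k.det_coe]
  have hE := Real.exp_pos t
  have h1 := congrArg (fun z : UpperHalfPlane => (z : ℂ)) h
  simp only [line, fermi, UpperHalfPlane.coe_specialLinearGroup_apply, Algebra.algebraMap_self,
    RingHom.id_apply] at h1
  have h0 : (stdFermi t 0 : ℂ) = ⟨0, Real.exp t⟩ := by
    apply Complex.ext <;> simp [stdFermi_re, stdFermi_im]
  have hN : 0 < (k 1 0) ^ 2 * Real.exp t ^ 2 + (k 1 1) ^ 2 := by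
    rcases eq_or_ne (k 1 0) 0 with hc | hc
    · have : k 1 1 ≠ 0 := by
        intro hd
        simp [hc, hd] at hdet
      positivity
    · positivity
  rw [h0, div_eq_iff] at h1
  swap
  · intro hz
    have hre := congrArg Complex.re hz
    have him := congrArg Complex.im hz
    simp at hre him
    simp [hre, him] at hN
  have hre := congrArg Complex.re h1
  have him := congrArg Complex.im h1
  simp [stdFermi_re, stdFermi_im] at hre him
  have hcs := Real.cosh_sq ρ
  have hcp := Real.cosh_pos ρ
  rw [Real.tanh_eq_sinh_div_cosh] at hre him ⊢
  refine ⟨hN, ?_, ?_⟩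
  · linear_combination (k 1 1) * hre + (k 1 0) * Real.exp t * him
  · have e : Real.exp s ^ 2 = (Real.exp s * (Real.sinh ρ / Real.cosh ρ)) ^ 2 +
        (Real.exp s / Real.cosh ρ) ^ 2 := by
      field_simp
      exact hcs
    rw [e]
    generalize Real.exp s * (Real.sinh ρ / Real.cosh ρ) = X at *
    generalize Real.exp s / Real.cosh ρ = Y at *
    linear_combination (-(k 0 1) + X * k 1 1 + Y * (k 1 0 * Real.exp t)) * hre -
      (k 0 0 * Real.exp t - X * (k 1 0 * Real.exp t) + Y * k 1 1) * him

/-! ### Lifting arcs to ℍ; geodesics as graphs over the normal direction -/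

section

theorem proj_eq_iff_exists {Γ : Subgroup SL2R} {z w : UpperHalfPlane} :
    proj Γ z = proj Γ w ↔ ∃ g ∈ Γ, g • z = w := by
  rw [eq_comm, proj, proj, Quotient.eq, MulAction.orbitRel_apply]
  constructor
  · rintro ⟨g, hg⟩
    exact ⟨g, g.2, hg⟩
  · rintro ⟨g, hg, h⟩
    exact ⟨⟨g, hg⟩, h⟩

theorem neg_one_smul (z : UpperHalfPlane) : (-1 : SL2R) • z = z := by
  ext
  simp [UpperHalfPlane.coe_specialLinearGroup_apply]

/-- Two lifts to `ℍ` of the same path in `ℍ / Γ` differ by one element of `Γ`. -/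
theorem IsSurfaceGroup.exists_smul_eqOn {Γ : Subgroup SL2R} (hΓ : IsSurfaceGroup Γ) {S : Set ℝ}
    (hS : IsPreconnected S) (hne : S.Nonempty) {f F : ℝ → UpperHalfPlane}
    (hf : ContinuousOn f S) (hF : ContinuousOn F S)
    (h : ∀ t ∈ S, proj Γ (f t) = proj Γ (F t)) :
    ∃ g ∈ Γ, ∀ t ∈ S, g • f t = F t := by
  have := hΓ.discrete
  obtain ⟨t₀, ht₀⟩ := hne
  obtain ⟨g, hg, hgt₀⟩ := proj_eq_iff_exists.1 (h t₀ ht₀)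
  refine ⟨g, hg, ?_⟩
  have : PreconnectedSpace S := Subtype.preconnectedSpace hS
  have hf' : Continuous fun t : S => g • f t :=
    (continuousOn_iff_continuous_domRestrict.1 hf).const_smul g
  have hF' : Continuous fun t : S => F t := continuousOn_iff_continuous_domRestrict.1 hF
  -- Openness: by proper discontinuity, an element relating the two lifts near `t` fixes `F t`;
  -- freeness then makes it `±1`, which acts trivially.
  have hclopen : IsClopen {t : S | g • f t = F t} := by
    refine ⟨isClosed_eq hf' hF', isOpen_iff_mem_nhds.2 fun t ht => ?_⟩
    obtain ⟨U, hU, hUg⟩ :=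
      ProperlyDiscontinuousSMul.exists_nhds_image_smul_eq_self Γ (F t)
    have hfU : ∀ᶠ t' : S in 𝓝 t, g • f t' ∈ U :=
      hf'.continuousAt.eventually (by
        change U ∈ 𝓝 (g • f t)
        rwa [show g • f t = F t from ht])
    have hFU : ∀ᶠ t' : S in 𝓝 t, F t' ∈ U := hF'.continuousAt.eventually hU
    filter_upwards [hfU, hFU] with t' h1 h2
    obtain ⟨g', hg', hgt'⟩ := proj_eq_iff_exists.1 (h t' t'.2)
    have hmem : g' * g⁻¹ ∈ Γ := Γ.mul_mem hg' (Γ.inv_mem hg)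
    have hmap : (g' * g⁻¹) • g • f t' = F t' := by rw [mul_smul, inv_smul_smul, hgt']
    have hfix : (g' * g⁻¹) • F t = F t :=
      hUg ⟨g' * g⁻¹, hmem⟩ ⟨F t', ⟨g • f t', h1, hmap⟩, h2⟩
    rcases hΓ.free _ hmem _ hfix with h1 | h1
    · rw [h1, one_smul] at hmap
      exact hmap
    · rw [h1, neg_one_smul] at hmap
      exact hmap
  have huniv := hclopen.eq_univ ⟨⟨t₀, ht₀⟩, hgt₀⟩
  intro t ht
  have hmem : (⟨t, ht⟩ : S) ∈ {t : S | g • f t = F t} := by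
    rw [huniv]
    exact mem_univ _
  exact hmem

namespace GeodesicArc

variable {Γ : Subgroup SL2R} (γ : GeodesicArc Γ)

theorem dom_nonempty : γ.dom.Nonempty := by
  obtain ⟨t, h⟩ := EReal.lt_iff_exists_real_btwn.1 γ.lo_lt_hi
  exact ⟨t, h⟩

theorem isPreconnected_dom : IsPreconnected γ.dom :=
  (ordConnected_Ioo.preimage_mono EReal.coe_strictMono.monotone).isPreconnected

theorem atLo_neBot : γ.atLo.NeBot := by
  refine comap_neBot fun S hS => ?_
  obtain ⟨u, hu, hS⟩ := (mem_nhdsGT_iff_exists_Ioo_subset' γ.lo_lt_hi).1 hS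
  obtain ⟨t, ht⟩ := EReal.lt_iff_exists_real_btwn.1 hu
  exact ⟨t, hS ht⟩

theorem atHi_neBot : γ.atHi.NeBot := by
  refine comap_neBot fun S hS => ?_
  obtain ⟨u, hu, hS⟩ := (mem_nhdsLT_iff_exists_Ioo_subset' γ.lo_lt_hi).1 hS
  obtain ⟨t, ht⟩ := EReal.lt_iff_exists_real_btwn.1 hu
  exact ⟨t, hS ht⟩

theorem dom_mem_atLo : γ.dom ∈ γ.atLo := preimage_mem_comap (Ioo_mem_nhdsGT γ.lo_lt_hi)

theorem dom_mem_atHi : γ.dom ∈ γ.atHi := preimage_mem_comap (Ioo_mem_nhdsLT γ.lo_lt_hi)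

theorem tendsto_coe_atLo : Tendsto (fun t : ℝ => (t : EReal)) γ.atLo (𝓝 γ.lo) :=
  tendsto_comap.mono_right nhdsWithin_le_nhds

theorem tendsto_coe_atHi : Tendsto (fun t : ℝ => (t : EReal)) γ.atHi (𝓝 γ.hi) :=
  tendsto_comap.mono_right nhdsWithin_le_nhds

end GeodesicArc

theorem continuous_line (g : SL2R) : Continuous (line g) :=
  (continuous_stdFermi.comp (continuous_id.prodMk continuous_const)).const_smul g

theorem fermi_inv_mul (g h : SL2R) (s ρ : ℝ) : fermi (g⁻¹ * h) s ρ = g⁻¹ • fermi h s ρ :=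
  mul_smul _ _ _

variable {Γ : Subgroup SL2R} {α : SimpleClosedGeodesic Γ} {r : EReal} {γ : GeodesicArc Γ}
  {s ρ : ℝ → ℝ}

/-- A crossing arc, developed in the Fermi coordinates of `α`, is a geodesic of `ℍ`. -/
theorem GeodesicArc.IsCrossing.exists_frame (hΓ : IsSurfaceGroup Γ)
    (h : γ.IsCrossing α r s ρ) : ∃ k : SL2R, ∀ t ∈ γ.dom, line k t = stdFermi (s t) (ρ t) := by
  have hF : ContinuousOn (fun t => fermi α.frame (s t) (ρ t)) γ.dom :=
    (continuous_stdFermi.comp_continuousOn (h.continuousOn_s.prodMk h.continuousOn_ρ)).const_smul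
      α.frame
  obtain ⟨g, -, hg⟩ := hΓ.exists_smul_eqOn γ.isPreconnected_dom γ.dom_nonempty
    (continuous_line γ.frame).continuousOn hF h.curve_eq
  refine ⟨α.frame⁻¹ * (g * γ.frame), fun t ht => ?_⟩
  have := hg t ht
  rw [line, fermi_inv_mul, fermi, mul_smul, ← fermi, ← line, this, fermi, inv_smul_smul]

/-- A geodesic of `ℍ` meeting both sides of the imaginary axis is the graph of
`s = s₀ + arsinh (c * tanh ρ)` in Fermi coordinates. -/
theorem exists_graph {k : SL2R} {D : Set ℝ}
    (h : ∀ t ∈ D, line k t = stdFermi (s t) (ρ t)) (hpos : ∃ t ∈ D, 0 < Real.tanh (ρ t))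
    (hneg : ∃ t ∈ D, Real.tanh (ρ t) < 0) :
    ∃ s₀ c : ℝ, ∀ t ∈ D, s t = s₀ + Real.arsinh (c * Real.tanh (ρ t)) := by
  obtain ⟨t₁, ht₁, h₁⟩ := hpos
  obtain ⟨t₂, ht₂, h₂⟩ := hneg
  obtain ⟨n₁, e₁, -⟩ := line_coords (h t₁ ht₁)
  obtain ⟨n₂, e₂, -⟩ := line_coords (h t₂ ht₂)
  have i₁ : k 0 0 * k 1 0 * Real.exp t₁ ^ 2 + k 0 1 * k 1 1 < 0 := by
    have := mul_pos n₁ (mul_pos (Real.exp_pos (s t₁)) h₁)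
    linarith
  have i₂ : 0 < k 0 0 * k 1 0 * Real.exp t₂ ^ 2 + k 0 1 * k 1 1 := by
    have := mul_neg_of_pos_of_neg n₂ (mul_neg_of_pos_of_neg (Real.exp_pos (s t₂)) h₂)
    linarith
  have E₁ : 0 < Real.exp t₁ ^ 2 := by positivity
  have E₂ : 0 < Real.exp t₂ ^ 2 := by positivity
  -- An affine function of `exp t ^ 2 > 0` changes sign, so its two coefficients have opposite
  -- signs. Geometrically, the ideal endpoints `a/c` and `b/d` of the geodesic are separated by `0`.
  have key : (k 0 0 * k 1 0) * (k 0 1 * k 1 1) < 0 := by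
    rcases lt_trichotomy (k 0 0 * k 1 0) 0 with hs | hs | hs
    · exact mul_neg_of_neg_of_pos hs (by nlinarith)
    · rw [hs] at i₁ i₂
      linarith
    · exact mul_neg_of_pos_of_neg hs (by nlinarith)
  have hcd : k 1 0 * k 1 1 ≠ 0 := by
    intro hz
    have : (k 0 0 * k 1 0) * (k 0 1 * k 1 1) = (k 0 0 * k 0 1) * (k 1 0 * k 1 1) := by ring
    rw [this, hz, mul_zero] at key
    exact key.false
  have hP : 0 < -(k 0 0 * k 0 1) / (k 1 0 * k 1 1) := by
    have : -(k 0 0 * k 0 1) / (k 1 0 * k 1 1) =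
        -((k 0 0 * k 1 0) * (k 0 1 * k 1 1)) / (k 1 0 * k 1 1) ^ 2 := by
      field_simp
    rw [this]
    exact div_pos (neg_pos.2 key) (by positivity)
  set P : ℝ := -(k 0 0 * k 0 1) / (k 1 0 * k 1 1) with hPdef
  have hs₀ : Real.exp (Real.log P / 2) ^ 2 = P := by
    rw [← Real.exp_nat_mul, Nat.cast_ofNat, mul_div_cancel₀ _ two_ne_zero, Real.exp_log hP]
  -- With endpoints `p = a/c`, `q = b/d`, the geodesic lies on `|z|² - (p + q) Re z + p q = 0`,
  -- where `|z| = exp s`, `Re z = -exp s * tanh ρ` and `p q = -P`. Dividing by `2 * exp s * √P`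
  -- gives `sinh (s - s₀) = c * tanh ρ` with `exp s₀ = √P` and the stated slope `c`.
  refine ⟨Real.log P / 2, -((k 0 0 * k 1 1 + k 0 1 * k 1 0) / (k 1 0 * k 1 1)) /
    (2 * Real.exp (Real.log P / 2)), fun t ht => ?_⟩
  obtain ⟨n, e, e'⟩ := line_coords (h t ht)
  have hquad : Real.exp (s t) ^ 2 + (k 0 0 * k 1 1 + k 0 1 * k 1 0) / (k 1 0 * k 1 1) *
      (Real.exp (s t) * Real.tanh (ρ t)) - P = 0 := by
    rw [hPdef]
    have : (k 1 0 * k 1 1) * Real.exp (s t) ^ 2 + (k 0 0 * k 1 1 + k 0 1 * k 1 0) *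
        (Real.exp (s t) * Real.tanh (ρ t)) + k 0 0 * k 0 1 = 0 := by
      refine (mul_eq_zero.1 ?_).resolve_left n.ne'
      linear_combination (k 1 0 * k 1 1) * e' + (k 0 0 * k 1 1 + k 0 1 * k 1 0) * e
    obtain ⟨hc, hd⟩ := mul_ne_zero_iff.1 hcd
    field_simp
    linarith
  rw [← sub_eq_iff_eq_add', eq_comm, ← Real.arsinh_sinh (s t - Real.log P / 2)]
  congr 1
  rw [Real.sinh_eq, neg_sub, Real.exp_sub, Real.exp_sub]
  have hx := Real.exp_pos (s t)
  have hy := Real.exp_pos (Real.log P / 2)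
  generalize Real.exp (s t) = x at *
  generalize Real.exp (Real.log P / 2) = y at *
  generalize (k 0 0 * k 1 1 + k 0 1 * k 1 0) / (k 1 0 * k 1 1) = q at *
  rw [← hs₀] at hquad
  field_simp
  linear_combination -hquad

theorem GeodesicArc.IsCrossing.tendsto_tanh (h : γ.IsCrossing α r s ρ) {U : ℝ}
    (hU : ∀ {l : Filter ℝ} {f : ℝ → ℝ}, Tendsto (fun t => (f t : EReal)) l (𝓝 r) →
        Tendsto (fun t => Real.tanh (f t)) l (𝓝 U)) :
    Tendsto (fun t => Real.tanh (ρ t)) γ.atLo (𝓝 (-U)) ∧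
      Tendsto (fun t => Real.tanh (ρ t)) γ.atHi (𝓝 U) := by
  refine ⟨?_, hU h.tendsto_hi⟩
  have h1 : Tendsto (fun t => ((-ρ t : ℝ) : EReal)) γ.atLo (𝓝 r) := by
    have := (continuous_neg.tendsto (-r)).comp h.tendsto_lo
    rw [neg_neg] at this
    exact this.congr fun t => (EReal.coe_neg _).symm
  simpa using (hU h1).neg

/-- The description of a crossing arc as a graph over the normal direction. -/
theorem GeodesicArc.IsCrossing.exists_graph (hΓ : IsSurfaceGroup Γ) (h : γ.IsCrossing α r s ρ)
    {U : ℝ} (hU0 : 0 < U)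
    (hU : ∀ {l : Filter ℝ} {f : ℝ → ℝ}, Tendsto (fun t => (f t : EReal)) l (𝓝 r) →
        Tendsto (fun t => Real.tanh (f t)) l (𝓝 U)) :
    ∃ s₀ c : ℝ, ∀ t ∈ γ.dom, s t = s₀ + Real.arsinh (c * Real.tanh (ρ t)) := by
  obtain ⟨k, hk⟩ := h.exists_frame hΓ
  have := γ.atLo_neBot
  have := γ.atHi_neBot
  obtain ⟨hlo, hhi⟩ := h.tendsto_tanh hU
  obtain ⟨t₁, h₁, ht₁⟩ := ((hhi.eventually_const_lt hU0).and γ.dom_mem_atHi).exists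
  obtain ⟨t₂, h₂, ht₂⟩ :=
    ((hlo.eventually_lt_const (neg_lt_zero.2 hU0)).and γ.dom_mem_atLo).exists
  exact HypSurf.exists_graph hk ⟨t₁, ht₁, h₁⟩ ⟨t₂, ht₂, h₂⟩

theorem tendsto_graph {l : Filter ℝ} {D : Set ℝ} (hD : D ∈ l) {s₀ c u : ℝ}
    (hs : ∀ t ∈ D, s t = s₀ + Real.arsinh (c * Real.tanh (ρ t)))
    (hρ : Tendsto (fun t => Real.tanh (ρ t)) l (𝓝 u)) :
    Tendsto s l (𝓝 (s₀ + Real.arsinh (c * u))) := by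
  have : Tendsto (fun t => s₀ + Real.arsinh (c * Real.tanh (ρ t))) l
      (𝓝 (s₀ + Real.arsinh (c * u))) := ((hρ.const_mul c).arsinh).const_add s₀
  exact this.congr' (eventually_of_mem hD fun t ht => (hs t ht).symm)

end

section

variable {Γ : Subgroup SL2R} {α : SimpleClosedGeodesic Γ} {r : EReal} {γ : GeodesicArc Γ}
  {s ρ s' ρ' : ℝ → ℝ}

/-! ### The winding number -/

/-- Two continuous lifts of the projection of a crossing arc to `α` differ by a constant. -/
theorem GeodesicArc.IsCrossing.exists_translation (hα : α.IsCollar r)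
    (h : γ.IsCrossing α r s ρ) (h' : γ.IsCrossing α r s' ρ') :
    ∃ n : ℤ, ∀ t ∈ γ.dom, s' t = s t + n * α.length := by
  have key : ∀ t ∈ γ.dom, ∃ n : ℤ, s' t = s t + n * α.length := fun t ht =>
    (hα.inj _ _ _ _ (h.abs_lt t ht) (h'.abs_lt t ht)
      ((h.curve_eq t ht).symm.trans (h'.curve_eq t ht))).2
  have hL := α.length_pos.ne'
  -- The difference of the lifts, in units of the length of `α`, is continuous and integer-valued on
  -- an interval, hence constant.
  have hdisc : DiscreteTopology (range ((↑) : ℤ → ℝ)) :=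
    Int.isClosedEmbedding_coe_real.isEmbedding.toHomeomorph.symm.isEmbedding.discreteTopology
  have hc : ContinuousOn (fun t => (s' t - s t) / α.length) γ.dom :=
    (h'.continuousOn_s.sub h.continuousOn_s).div_const _
  have hm : MapsTo (fun t => (s' t - s t) / α.length) γ.dom (range ((↑) : ℤ → ℝ)) := by
    intro t ht
    obtain ⟨n, hn⟩ := key t ht
    refine ⟨n, ?_⟩
    simp only [hn, add_sub_cancel_left, mul_div_cancel_right₀ _ hL]
  obtain ⟨t₀, ht₀⟩ := γ.dom_nonempty
  obtain ⟨n, hn⟩ := key t₀ ht₀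
  refine ⟨n, fun t ht => ?_⟩
  have := γ.isPreconnected_dom.constant_of_mapsTo ⟨hdisc⟩ hc hm ht ht₀
  simp only [hn, add_sub_cancel_left, mul_div_cancel_right₀ _ hL] at this
  rw [div_eq_iff hL] at this
  linarith

theorem GeodesicArc.HasWinding.unique (hα : α.IsCollar r) {w w' : ℝ} (h : γ.HasWinding α r w)
    (h' : γ.HasWinding α r w') : w = w' := by
  obtain ⟨s, ρ, hs, a, b, ha, hb, rfl⟩ := h
  obtain ⟨s', ρ', hs', a', b', ha', hb', rfl⟩ := h'
  obtain ⟨n, hn⟩ := hs.exists_translation hα hs'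
  have := γ.atLo_neBot
  have := γ.atHi_neBot
  have h1 : a' = a + n * α.length := tendsto_nhds_unique ha'
    ((ha.add_const _).congr' (eventually_of_mem γ.dom_mem_atLo fun t ht => (hn t ht).symm))
  have h2 : b' = b + n * α.length := tendsto_nhds_unique hb'
    ((hb.add_const _).congr' (eventually_of_mem γ.dom_mem_atHi fun t ht => (hn t ht).symm))
  rw [h1, h2, add_sub_add_right_eq_sub]

theorem GeodesicArc.Crosses.existsUnique_hasWinding (hΓ : IsSurfaceGroup Γ) (hα : α.IsCollar r)
    (h : γ.Crosses α r) : ∃! w : ℝ, γ.HasWinding α r w := by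
  obtain ⟨s, ρ, h⟩ := h
  obtain ⟨U, hU0, -, -, hU⟩ := exists_tanh_width hα.pos
  obtain ⟨s₀, c, hs⟩ := h.exists_graph hΓ hU0 hU
  obtain ⟨hlo, hhi⟩ := h.tendsto_tanh hU
  have hw : γ.HasWinding α r _ := ⟨s, ρ, h, _, _, tendsto_graph γ.dom_mem_atLo hs hlo,
    tendsto_graph γ.dom_mem_atHi hs hhi, rfl⟩
  exact ⟨_, hw, fun w' hw' => hw'.unique hα hw⟩

/-! ### The length of a crossing arc -/

/-- Between two parameters of the developed geodesic, elapsed time is hyperbolic distance, which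
`cosh_dist_stdFermi` expresses in Fermi coordinates. The formula follows by letting the two
parameters tend to the two ends independently; finiteness of the length comes with the limit. -/
theorem GeodesicArc.IsCrossing.length_eq (hΓ : IsSurfaceGroup Γ) {r : ℝ}
    (h : γ.IsCrossing α (r : EReal) s ρ) {a b : ℝ} (ha : Tendsto s γ.atLo (𝓝 a))
    (hb : Tendsto s γ.atHi (𝓝 b)) :
    γ.length = (Real.arcosh (Real.cosh r ^ 2 * Real.cosh (b - a) + Real.sinh r ^ 2) : ℝ) := by
  obtain ⟨k, hk⟩ := h.exists_frame hΓ
  have := γ.atLo_neBot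
  have := γ.atHi_neBot
  have hρlo : Tendsto ρ γ.atLo (𝓝 (-r)) := by
    have := h.tendsto_lo
    rw [← EReal.coe_neg] at this
    exact EReal.tendsto_coe.1 this
  have hρhi : Tendsto ρ γ.atHi (𝓝 r) := EReal.tendsto_coe.1 h.tendsto_hi
  obtain ⟨q, hq₁, hq₂⟩ := EReal.lt_iff_exists_real_btwn.1 γ.lo_lt_hi
  have hfst : Tendsto Prod.fst (γ.atLo ×ˢ γ.atHi) γ.atLo := tendsto_fst
  have hsnd : Tendsto Prod.snd (γ.atLo ×ˢ γ.atHi) γ.atHi := tendsto_snd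
  have hlim : Tendsto (fun p : ℝ × ℝ => Real.arcosh (Real.cosh (ρ p.2) * Real.cosh (ρ p.1) *
      Real.cosh (s p.2 - s p.1) - Real.sinh (ρ p.2) * Real.sinh (ρ p.1))) (γ.atLo ×ˢ γ.atHi)
      (𝓝 (Real.arcosh (Real.cosh r ^ 2 * Real.cosh (b - a) + Real.sinh r ^ 2))) := by
    have c1 := (Real.continuous_cosh.tendsto _).comp (hρhi.comp hsnd)
    have c2 := (Real.continuous_cosh.tendsto _).comp (hρlo.comp hfst)
    have c3 := (Real.continuous_cosh.tendsto _).comp ((hb.comp hsnd).sub (ha.comp hfst))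
    have c4 := (Real.continuous_sinh.tendsto _).comp (hρhi.comp hsnd)
    have c5 := (Real.continuous_sinh.tendsto _).comp (hρlo.comp hfst)
    have c6 := ((c1.mul c2).mul c3).sub (c4.mul c5)
    rw [Real.cosh_neg, Real.sinh_neg, mul_neg, sub_neg_eq_add, ← sq, ← sq] at c6
    have h1 : (1 : ℝ) ≤ Real.cosh r ^ 2 * Real.cosh (b - a) + Real.sinh r ^ 2 := by
      have := Real.cosh_sq r
      nlinarith [Real.one_le_cosh (b - a), sq_nonneg (Real.sinh r)]
    refine (Real.continuousOn_arcosh _ h1).tendsto.comp (tendsto_nhdsWithin_iff.2 ⟨c6, ?_⟩)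
    filter_upwards [prod_mem_prod γ.dom_mem_atLo γ.dom_mem_atHi] with p hp
    simp only [mem_Ici, ← cosh_dist_stdFermi]
    exact Real.one_le_cosh _
  have hlim' : Tendsto (fun p : ℝ × ℝ => ((p.2 : EReal) - (p.1 : EReal))) (γ.atLo ×ˢ γ.atHi)
      (𝓝 (Real.arcosh (Real.cosh r ^ 2 * Real.cosh (b - a) + Real.sinh r ^ 2) : ℝ)) := by
    refine (EReal.tendsto_coe.2 hlim).congr' ?_
    filter_upwards [prod_mem_prod γ.dom_mem_atLo γ.dom_mem_atHi,
      prod_mem_prod (γ.tendsto_coe_atLo.eventually_lt_const hq₁)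
        (γ.tendsto_coe_atHi.eventually_const_lt hq₂)] with p hp hlt
    have hlt' : p.1 < p.2 := (EReal.coe_lt_coe_iff.1 hlt.1).trans (EReal.coe_lt_coe_iff.1 hlt.2)
    rw [← cosh_dist_stdFermi, ← hk _ hp.1, ← hk _ hp.2, cosh_dist_line,
      Real.arcosh_cosh (sub_nonneg.2 hlt'.le), EReal.coe_sub]
  refine tendsto_nhds_unique ?_ hlim'
  -- Extended addition is continuous here since `hi ≠ ⊥` and `lo ≠ ⊤`, so `∞ - ∞` cannot occur.
  have hcont : ContinuousAt (fun p : EReal × EReal => p.1 + p.2) (γ.hi, -γ.lo) :=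
    EReal.continuousAt_add
      (Or.inr (by simpa [EReal.neg_eq_bot_iff] using γ.lo_lt_hi.ne_top))
      (Or.inl γ.lo_lt_hi.ne_bot)
  exact hcont.tendsto.comp ((γ.tendsto_coe_atHi.comp hsnd).prodMk_nhds
    ((continuous_neg.tendsto γ.lo).comp (γ.tendsto_coe_atLo.comp hfst)))

/-- For `y ≥ 0`, `cosh y` lies between `exp y / 2` and `exp y`. The lower bound loses `1/4` from
`cosh² r` and `1/2` from `cosh x`, whence `8`; the upper bound needs only a factor `4`. -/
theorem abs_arcosh_sub_le {r : ℝ} (hr : 0 ≤ r) (x : ℝ) :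
    |Real.arcosh (Real.cosh r ^ 2 * Real.cosh x + Real.sinh r ^ 2) - (2 * r + |x|)| ≤
      Real.log 8 := by
  have hcs := Real.cosh_sq r
  have hcx := Real.one_le_cosh x
  have h1 : (1 : ℝ) ≤ Real.cosh r ^ 2 * Real.cosh x + Real.sinh r ^ 2 := by
    nlinarith [sq_nonneg (Real.sinh r)]
  set l := Real.arcosh (Real.cosh r ^ 2 * Real.cosh x + Real.sinh r ^ 2) with hl
  have hl0 : 0 ≤ l := Real.arcosh_nonneg h1
  have hcl : Real.cosh l = Real.cosh r ^ 2 * Real.cosh x + Real.sinh r ^ 2 := Real.cosh_arcosh h1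
  have bounds : ∀ y : ℝ, 0 ≤ y → Real.exp y / 2 ≤ Real.cosh y ∧ Real.cosh y ≤ Real.exp y := by
    intro y hy
    have h2 : Real.exp (-y) ≤ Real.exp y := Real.exp_le_exp.2 (by linarith)
    rw [Real.cosh_eq]
    constructor <;> linarith [Real.exp_pos (-y)]
  obtain ⟨l1, l2⟩ := bounds l hl0
  obtain ⟨r1, r2⟩ := bounds r hr
  obtain ⟨x1, x2⟩ := bounds |x| (abs_nonneg x)
  rw [Real.cosh_abs] at x1 x2
  have er := Real.exp_pos r
  have ex : 1 ≤ Real.exp |x| := Real.one_le_exp (abs_nonneg x)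
  have hsum : Real.exp (2 * r + |x|) = Real.exp r ^ 2 * Real.exp |x| := by
    rw [two_mul, Real.exp_add, Real.exp_add, sq]
  have hc2 : Real.cosh r ^ 2 ≤ Real.exp r ^ 2 :=
    pow_le_pow_left₀ (Real.cosh_pos r).le r2 2
  have hc2' : (Real.exp r / 2) ^ 2 ≤ Real.cosh r ^ 2 := pow_le_pow_left₀ (by positivity) r1 2
  have hprod : Real.cosh r ^ 2 * Real.cosh x ≤ Real.exp r ^ 2 * Real.exp |x| :=
    mul_le_mul hc2 x2 (by positivity) (by positivity)
  have hprod' : (Real.exp r / 2) ^ 2 * (Real.exp |x| / 2) ≤ Real.cosh r ^ 2 * Real.cosh x :=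
    mul_le_mul hc2' x1 (by positivity) (by positivity)
  have h8 : Real.exp (Real.log 8) = 8 := Real.exp_log (by norm_num)
  rw [abs_le]
  constructor
  · have : Real.exp (2 * r + |x|) ≤ Real.exp (l + Real.log 8) := by
      rw [Real.exp_add l, h8, hsum]
      nlinarith [sq_nonneg (Real.sinh r)]
    linarith [Real.exp_le_exp.1 this]
  · have : Real.exp l ≤ Real.exp ((2 * r + |x|) + Real.log 8) := by
      rw [Real.exp_add (2 * r + |x|), h8, hsum]
      have : Real.exp r ^ 2 * 1 ≤ Real.exp r ^ 2 * Real.exp |x| :=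
        mul_le_mul_of_nonneg_left ex (by positivity)
      nlinarith [Real.exp_pos l]
    linarith [Real.exp_le_exp.1 this]

theorem GeodesicArc.HasWinding.abs_length_sub_le (hΓ : IsSurfaceGroup Γ) {r : ℝ}
    (hα : α.IsCollar (r : EReal)) {w : ℝ} (h : γ.HasWinding α (r : EReal) w) :
    ∃ ℓ : ℝ, γ.length = (ℓ : EReal) ∧ |ℓ - (2 * r + |w| * α.length)| ≤ Real.log 8 := by
  obtain ⟨s, ρ, hs, a, b, ha, hb, rfl⟩ := h
  refine ⟨_, hs.length_eq hΓ ha hb, ?_⟩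
  rw [abs_div, abs_of_pos α.length_pos, div_mul_cancel₀ _ α.length_pos.ne']
  exact abs_arcosh_sub_le (EReal.coe_pos.1 hα.pos).le (b - a)

end

section

/-! ### Counting intersections -/

/-- This is the `u`-derivative of `arsinh (c * u)`. For `u ≠ 0` it equals `tanh (arsinh (c * u)) /
u`, which increases in `c` for either sign of `u`. -/
theorem strictMono_div_sqrt (u : ℝ) : StrictMono fun c : ℝ => c / √(1 + (c * u) ^ 2) := by
  rcases eq_or_ne u 0 with rfl | hu
  · intro c c' h
    simpa using h
  intro c c' h
  have key : ∀ c : ℝ, c / √(1 + (c * u) ^ 2) = Real.tanh (Real.arsinh (c * u)) / u := by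
    intro c
    rw [Real.tanh_arsinh]
    field_simp
  simp only [key]
  rcases hu.lt_or_gt with hu | hu
  · exact (div_lt_div_right_of_neg hu).2
      (tanh_strictMono (Real.arsinh_strictMono (mul_lt_mul_of_neg_right h hu)))
  · exact (div_lt_div_iff_of_pos_right hu).2
      (tanh_strictMono (Real.arsinh_strictMono (mul_lt_mul_of_pos_right h hu)))

theorem strictMono_arsinh_sub {c c' : ℝ} (h : c < c') :
    StrictMono fun u : ℝ => Real.arsinh (c' * u) - Real.arsinh (c * u) := by
  have hd : ∀ c u : ℝ, HasDerivAt (fun u => Real.arsinh (c * u)) (c / √(1 + (c * u) ^ 2)) u := by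
    intro c u
    have := ((hasDerivAt_id u).const_mul c).arsinh
    simpa [div_eq_inv_mul] using this
  refine strictMono_of_hasDerivAt_pos (fun u => (hd c' u).sub (hd c u)) fun u => ?_
  exact sub_pos.2 (strictMono_div_sqrt u h)

/-- The number of integers in an open interval of length `y - x`. -/
theorem ncard_int_between {x y : ℝ} (h : x < y) :
    {n : ℤ | x < n ∧ (n : ℝ) < y}.Finite ∧
      |(({n : ℤ | x < n ∧ (n : ℝ) < y}.ncard : ℝ)) - (y - x)| ≤ 1 := by
  have hset : {n : ℤ | x < n ∧ (n : ℝ) < y} = (Finset.Ioo ⌊x⌋ ⌈y⌉ : Finset ℤ) := by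
    ext n
    simp [Int.floor_lt, Int.lt_ceil]
  have hlt : ⌊x⌋ < ⌈y⌉ := Int.floor_lt_ceil_of_lt h
  have hcard := Int.card_Ioo_of_lt _ _ hlt
  rw [hset]
  refine ⟨Finset.finite_toSet _, ?_⟩
  have hcard' : ((Finset.Ioo ⌊x⌋ ⌈y⌉).card : ℝ) = ⌈y⌉ - ⌊x⌋ - 1 := by exact_mod_cast hcard
  rw [Set.ncard_coe_finset, hcard', abs_le]
  constructor <;>
    linarith [Int.floor_le x, Int.lt_floor_add_one x, Int.le_ceil y, Int.ceil_lt_add_one y]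

/-- The number of integral values of a continuous strictly increasing function. -/
theorem ncard_int_values {f : ℝ → ℝ} (hf : StrictMono f) (hc : Continuous f) {u v : ℝ}
    (huv : u < v) :
    {x ∈ Ioo u v | ∃ n : ℤ, f x = n}.Finite ∧
      |({x ∈ Ioo u v | ∃ n : ℤ, f x = n}.ncard : ℝ) - (f v - f u)| ≤ 1 := by
  obtain ⟨hfin, hcard⟩ := ncard_int_between (hf huv)
  set A := {x ∈ Ioo u v | ∃ n : ℤ, f x = n}
  have himg : f '' A = ((↑) : ℤ → ℝ) '' {n : ℤ | f u < n ∧ (n : ℝ) < f v} := by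
    ext y
    constructor
    · rintro ⟨x, ⟨hx, n, hn⟩, rfl⟩
      exact ⟨n, ⟨by rw [← hn]; exact hf hx.1, by rw [← hn]; exact hf hx.2⟩, hn.symm⟩
    · rintro ⟨n, hn, rfl⟩
      obtain ⟨x, hx, hxn⟩ := intermediate_value_Ioo huv.le hc.continuousOn hn
      exact ⟨x, ⟨hx, n, hxn⟩, hxn⟩
  have hfinA : A.Finite := by
    rw [← finite_image_iff hf.injective.injOn, himg]
    exact hfin.image _
  refine ⟨hfinA, ?_⟩
  rwa [← ncard_image_of_injective A hf.injective, himg,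
    ncard_image_of_injective _ Int.cast_injective]

variable {Γ : Subgroup SL2R} {α : SimpleClosedGeodesic Γ} {r : EReal} {γ γ' : GeodesicArc Γ}
  {s ρ s' ρ' : ℝ → ℝ}

theorem GeodesicArc.IsCrossing.carrier_eq (h : γ.IsCrossing α r s ρ) {U : ℝ}
    (hUr : ∀ x : ℝ, ((|x| : ℝ) : EReal) < r ↔ |Real.tanh x| < U)
    (hU : ∀ {l : Filter ℝ} {f : ℝ → ℝ}, Tendsto (fun t => (f t : EReal)) l (𝓝 r) →
        Tendsto (fun t => Real.tanh (f t)) l (𝓝 U)) {s₀ c : ℝ}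
    (hs : ∀ t ∈ γ.dom, s t = s₀ + Real.arsinh (c * Real.tanh (ρ t))) :
    γ.carrier =
      (fun u => α.normal (s₀ + Real.arsinh (c * u)) (Real.artanh u)) '' Ioo (-U) U := by
  apply Subset.antisymm
  · rintro _ ⟨t, ht, rfl⟩
    refine ⟨Real.tanh (ρ t), _root_.abs_lt.1 ((hUr _).1 (h.abs_lt t ht)), ?_⟩
    simp only [Real.artanh_tanh]
    rw [← hs t ht, h.curve_eq t ht]
  · rintro _ ⟨u, hu, rfl⟩
    have := γ.atLo_neBot
    have := γ.atHi_neBot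
    obtain ⟨hlo, hhi⟩ := h.tendsto_tanh hU
    obtain ⟨t₁, h₁, ht₁⟩ := ((hhi.eventually_const_lt hu.2).and γ.dom_mem_atHi).exists
    obtain ⟨t₂, h₂, ht₂⟩ := ((hlo.eventually_lt_const hu.1).and γ.dom_mem_atLo).exists
    -- Monotonicity of `ρ` is not needed: its limits at the two ends force `tanh ρ` to take every
    -- value in `(-U, U)`.
    obtain ⟨t, ht, htu⟩ := γ.isPreconnected_dom.intermediate_value ht₂ ht₁
      (continuous_tanh.comp_continuousOn h.continuousOn_ρ) ⟨h₂.le, h₁.le⟩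
    refine ⟨t, ht, ?_⟩
    simp only [Function.comp] at htu
    simp only [h.curve_eq t ht, hs t ht, ← htu, Real.artanh_tanh]

/-- An isometry which translates the imaginary axis preserves the distance to it. -/
theorem smul_stdFermi_of_line {k : SL2R} {l : ℝ} (hk : ∀ t, line k t = stdFermi (t + l) 0)
    (s ρ : ℝ) : k • stdFermi s ρ = stdFermi (s + l) ρ := by
  have hdet : k 0 0 * k 1 1 - k 0 1 * k 1 0 = 1 := by
    rw [← Matrix.det_fin_two, k.det_coe]
  obtain ⟨-, e₁, f₁⟩ := line_coords (hk 0)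
  obtain ⟨-, e₂, f₂⟩ := line_coords (hk 1)
  simp only [Real.tanh_zero, mul_zero, Real.exp_zero, one_pow, mul_one, Real.exp_add, zero_add,
    mul_pow] at e₁ e₂ f₁ f₂
  have hq : 1 < Real.exp 1 ^ 2 := one_lt_pow₀ (Real.one_lt_exp_iff.2 one_pos) two_ne_zero
  have hM : 0 < Real.exp l := Real.exp_pos l
  have hac : k 0 0 * k 1 0 = 0 := by
    refine (mul_eq_zero.1 (?_ : k 0 0 * k 1 0 * (Real.exp 1 ^ 2 - 1) = 0)).resolve_right
      (sub_pos.2 hq).ne'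
    linarith
  have hbd : k 0 1 * k 1 1 = 0 := by linarith
  -- The alternative `a = d = 0` would reverse the axis, which the images of the two points `t = 0,
  -- 1` exclude.
  have hc : k 1 0 = 0 := by
    refine (mul_eq_zero.1 hac).resolve_left fun ha => ?_
    have hd : k 1 1 = 0 := by
      refine (mul_eq_zero.1 hbd).resolve_left fun hb => ?_
      simp [ha, hb] at hdet
    have hc : k 1 0 ≠ 0 := by
      intro hc
      simp [ha, hc] at hdet
    rw [ha, hd] at f₁ f₂
    have : 0 < k 1 0 ^ 2 * Real.exp l ^ 2 := by positivity
    have h4 : 1 < Real.exp 1 ^ 2 * Real.exp 1 ^ 2 := by nlinarith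
    nlinarith
  have hd : k 1 1 ≠ 0 := by
    intro hd
    simp [hc, hd] at hdet
  have hb : k 0 1 = 0 := (mul_eq_zero.1 hbd).resolve_right hd
  rw [hb, hc] at f₁ hdet
  have had : k 0 0 = Real.exp l * k 1 1 := by
    have h1 : (k 0 0 - Real.exp l * k 1 1) * (k 0 0 + Real.exp l * k 1 1) = 0 := by
      linear_combination -f₁
    rcases mul_eq_zero.1 h1 with h1 | h1
    · linarith
    · have : 0 < Real.exp l * k 1 1 ^ 2 := by positivity
      have h2 : k 0 0 = -(Real.exp l * k 1 1) := by linarith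
      rw [h2] at hdet
      nlinarith
  ext
  rw [UpperHalfPlane.coe_specialLinearGroup_apply]
  simp only [Algebra.algebraMap_self, RingHom.id_apply, hb, hc, had]
  have : (k 1 1 : ℂ) ≠ 0 := Complex.ofReal_ne_zero.2 hd
  rw [Complex.ofReal_zero, zero_mul, zero_add, add_zero, Complex.ofReal_mul, mul_right_comm,
    mul_div_cancel_right₀ _ this]
  apply Complex.ext
  · rw [Complex.re_ofReal_mul]
    change Real.exp l * -(Real.exp s * Real.tanh ρ) = -(Real.exp (s + l) * Real.tanh ρ)
    rw [Real.exp_add]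
    ring
  · rw [Complex.im_ofReal_mul]
    change Real.exp l * (Real.exp s / Real.cosh ρ) = Real.exp (s + l) / Real.cosh ρ
    rw [Real.exp_add]
    ring

/-- The normal exponential map of a closed geodesic is periodic. -/
theorem SimpleClosedGeodesic.normal_add (hΓ : IsSurfaceGroup Γ) (α : SimpleClosedGeodesic Γ)
    (x ρ : ℝ) (n : ℤ) : α.normal (x + n * α.length) ρ = α.normal x ρ := by
  -- Closing up is known only pointwise along `α`. Lifting uniqueness yields a single deck
  -- transformation translating the axis, and it therefore translates all Fermi coordinates.
  obtain ⟨g, hg, h⟩ := hΓ.exists_smul_eqOn isPreconnected_univ univ_nonempty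
    (continuous_line α.frame).continuousOn
    ((continuous_line α.frame).comp (continuous_add_const (n * α.length))).continuousOn
    (fun t _ => (α.proj_eq_iff t (t + n * α.length)).2 ⟨n, rfl⟩)
  have hk : ∀ t, line (α.frame⁻¹ * (g * α.frame)) t = stdFermi (t + n * α.length) 0 := by
    intro t
    have := h t (mem_univ t)
    simp only [Function.comp] at this
    rw [line, fermi_inv_mul, fermi, mul_smul, ← fermi, ← line, this, line, fermi, inv_smul_smul]
  refine (proj_eq_iff_exists.2 ⟨g, hg, ?_⟩).symm
  rw [fermi, fermi, ← smul_stdFermi_of_line hk, mul_smul, smul_inv_smul, mul_smul]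

/-- Two geodesic graphs in a collar, with `c ≤ c'`. -/
theorem ncard_inter_graph (hΓ : IsSurfaceGroup Γ) (hα : α.IsCollar r) {U : ℝ} (hU0 : 0 < U) (hU1 : U ≤ 1)
    (hUr : ∀ x : ℝ, ((|x| : ℝ) : EReal) < r ↔ |Real.tanh x| < U) {s₀ c s₀' c' : ℝ} (hcc : c ≤ c')
    {A A' : Set (Surface Γ)}
    (hA : A = (fun u => α.normal (s₀ + Real.arsinh (c * u)) (Real.artanh u)) '' Ioo (-U) U)
    (hA' : A' = (fun u => α.normal (s₀' + Real.arsinh (c' * u)) (Real.artanh u)) '' Ioo (-U) U)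
    (hne : A ≠ A') :
    (A ∩ A').Finite ∧ |((A ∩ A').ncard : ℝ) -
      2 * (Real.arsinh (c' * U) - Real.arsinh (c * U)) / α.length| ≤ 1 := by
  have hL := α.length_pos
  have htanh : ∀ u ∈ Ioo (-U) U, Real.tanh (Real.artanh u) = u := fun u hu =>
    Real.tanh_artanh ⟨by linarith [hu.1], hu.2.trans_le hU1⟩
  have hwidth : ∀ u ∈ Ioo (-U) U, ((|Real.artanh u| : ℝ) : EReal) < r := fun u hu => by
    rw [hUr, htanh u hu]
    exact abs_lt.2 hu
  have heq : ∀ u ∈ Ioo (-U) U, ∀ v ∈ Ioo (-U) U, ∀ x y : ℝ,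
      α.normal x (Real.artanh u) = α.normal y (Real.artanh v) →
        u = v ∧ ∃ n : ℤ, y = x + n * α.length := fun u hu v hv x y h => by
    obtain ⟨h1, h2⟩ := hα.inj _ _ _ _ (hwidth u hu) (hwidth v hv) h
    exact ⟨by rw [← htanh u hu, h1, htanh v hv], h2⟩
  -- Gap between the graphs over `u`, in units of the length of `α`: the arcs meet over `u` exactly
  -- when it is an integer.
  set f : ℝ → ℝ := fun u =>
    ((s₀' - s₀) + (Real.arsinh (c' * u) - Real.arsinh (c * u))) / α.length with hf
  have hfn : ∀ (u : ℝ) (n : ℤ), f u = n ↔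
      s₀' + Real.arsinh (c' * u) = s₀ + Real.arsinh (c * u) + n * α.length := by
    intro u n
    rw [hf, div_eq_iff hL.ne']
    constructor <;> intro h <;> linarith
  have hinter : A ∩ A' = (fun u => α.normal (s₀ + Real.arsinh (c * u)) (Real.artanh u)) ''
      {u ∈ Ioo (-U) U | ∃ n : ℤ, f u = n} := by
    rw [hA, hA']
    ext x
    constructor
    · rintro ⟨⟨u, hu, rfl⟩, v, hv, hvx⟩
      obtain ⟨rfl, n, hn⟩ := heq u hu v hv _ _ hvx.symm
      exact ⟨u, ⟨hu, n, (hfn u n).2 hn⟩, rfl⟩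
    · rintro ⟨u, ⟨hu, n, hn⟩, rfl⟩
      refine ⟨⟨u, hu, rfl⟩, u, hu, ?_⟩
      simp only [(hfn u n).1 hn, α.normal_add hΓ]
  have hinj : InjOn (fun u => α.normal (s₀ + Real.arsinh (c * u)) (Real.artanh u))
      {u ∈ Ioo (-U) U | ∃ n : ℤ, f u = n} := fun u hu v hv h => (heq u hu.1 v hv.1 _ _ h).1
  rcases hcc.eq_or_lt with rfl | hlt
  -- Equal slopes make the gap constant; an integer value would make the two carriers coincide.
  · have hempty : {u ∈ Ioo (-U) U | ∃ n : ℤ, f u = n} = ∅ := by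
      refine eq_empty_of_forall_notMem fun u hu => hne ?_
      obtain ⟨-, n, hn⟩ := hu
      have hs : s₀' = s₀ + n * α.length := by linarith [(hfn u n).1 hn]
      rw [hA, hA']
      refine image_congr fun v hv => ?_
      rw [hs, add_right_comm, α.normal_add hΓ]
    rw [hinter, hempty]
    simp
  · have hmono : StrictMono f := fun u v huv =>
      div_lt_div_of_pos_right (by simpa using strictMono_arsinh_sub hlt huv) hL
    have hcont : Continuous f := by
      have h1 : ∀ c : ℝ, Continuous fun u : ℝ => Real.arsinh (c * u) := fun c =>
        (continuous_const.mul continuous_id).arsinh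
      exact (continuous_const.add ((h1 c').sub (h1 c))).div_const _
    obtain ⟨hfin, hcard⟩ := ncard_int_values hmono hcont (neg_lt_self hU0)
    rw [hinter]
    refine ⟨hfin.image _, ?_⟩
    rw [hinj.ncard_image]
    -- As `arsinh` is odd, the offset `s₀' - s₀` cancels in `f U - f (-U)`.
    convert hcard using 4
    simp only [hf, mul_neg, Real.arsinh_neg]
    ring

theorem GeodesicArc.HasWinding.ncard_inter (hΓ : IsSurfaceGroup Γ) (hα : α.IsCollar r) {w w' : ℝ}
    (h : γ.HasWinding α r w) (h' : γ'.HasWinding α r w') (hne : γ.carrier ≠ γ'.carrier) :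
    (γ.carrier ∩ γ'.carrier).Finite ∧
      |((γ.carrier ∩ γ'.carrier).ncard : ℝ) - (|w - w'|)| ≤ 1 := by
  obtain ⟨U, hU0, hU1, hUr, hU⟩ := exists_tanh_width hα.pos
  have main : ∀ {γ : GeodesicArc Γ} {w : ℝ}, γ.HasWinding α r w → ∃ s₀ c : ℝ,
      γ.carrier =
        (fun u => α.normal (s₀ + Real.arsinh (c * u)) (Real.artanh u)) '' Ioo (-U) U ∧
      w = 2 * Real.arsinh (c * U) / α.length := by
    rintro γ w ⟨s, ρ, hs, a, b, ha, hb, rfl⟩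
    obtain ⟨s₀, c, hsc⟩ := hs.exists_graph hΓ hU0 hU
    obtain ⟨hlo, hhi⟩ := hs.tendsto_tanh hU
    have := γ.atLo_neBot
    have := γ.atHi_neBot
    refine ⟨s₀, c, hs.carrier_eq hUr hU hsc, ?_⟩
    rw [tendsto_nhds_unique ha (tendsto_graph γ.dom_mem_atLo hsc hlo),
      tendsto_nhds_unique hb (tendsto_graph γ.dom_mem_atHi hsc hhi), mul_neg, Real.arsinh_neg]
    ring
  obtain ⟨s₀, c, hA, rfl⟩ := main h
  obtain ⟨s₀', c', hA', rfl⟩ := main h'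
  have hw : ∀ {c c' : ℝ}, c ≤ c' → 2 * (Real.arsinh (c' * U) - Real.arsinh (c * U)) / α.length =
      |2 * Real.arsinh (c * U) / α.length - 2 * Real.arsinh (c' * U) / α.length| := by
    intro c c' hcc
    have h1 : Real.arsinh (c * U) ≤ Real.arsinh (c' * U) :=
      Real.arsinh_le_arsinh.2 (mul_le_mul_of_nonneg_right hcc hU0.le)
    rw [abs_sub_comm, ← sub_div, ← mul_sub, abs_of_nonneg]
    exact div_nonneg (mul_nonneg zero_le_two (sub_nonneg.2 h1)) α.length_pos.le
  rcases le_total c c' with hcc | hcc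
  · rw [← hw hcc]
    exact ncard_inter_graph hΓ hα hU0 hU1 hUr hcc hA hA' hne
  · rw [inter_comm, abs_sub_comm (2 * _ / _), ← hw hcc]
    exact ncard_inter_graph hΓ hα hU0 hU1 hUr hcc hA' hA hne.symm

end

end HypSurf

open HypSurf
theorem theorem2p1 :
    -- winding numbers are defined: an arc crossing a collar has exactly one
    (∀ (Γ : Subgroup SL2R), IsSurfaceGroup Γ →
      ∀ (α : SimpleClosedGeodesic Γ) (r : EReal), α.IsCollar r →
      ∀ γ : GeodesicArc Γ, γ.Crosses α r → ∃! w : ℝ, γ.HasWinding α r w) ∧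
    -- lengths, for collars of finite width, with an absolute constant
    (∃ C : ℝ, ∀ (Γ : Subgroup SL2R), IsSurfaceGroup Γ →
      ∀ (α : SimpleClosedGeodesic Γ) (r : ℝ), α.IsCollar (r : EReal) →
      ∀ (γ : GeodesicArc Γ) (w : ℝ), γ.HasWinding α (r : EReal) w →
        ∃ ℓ : ℝ, γ.length = (ℓ : EReal) ∧ |ℓ - (2 * r + |w| * α.length)| ≤ C) ∧
    -- crossings, for collars of finite or infinite width
    (∀ (Γ : Subgroup SL2R), IsSurfaceGroup Γ →
      ∀ (α : SimpleClosedGeodesic Γ) (r : EReal), α.IsCollar r →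
      ∀ (γ γ' : GeodesicArc Γ) (w w' : ℝ), γ.HasWinding α r w → γ'.HasWinding α r w' →
        γ.carrier ≠ γ'.carrier →
        (γ.carrier ∩ γ'.carrier).Finite ∧
          |((γ.carrier ∩ γ'.carrier).ncard : ℝ) - (|w - w'|)| ≤ 1) := by
  refine ⟨fun Γ hΓ α r hα γ h => h.existsUnique_hasWinding hΓ hα,
    ⟨Real.log 8, fun Γ hΓ α r hα γ w h => h.abs_length_sub_le hΓ hα⟩,
    fun Γ hΓ α r hα γ γ' w w' h h' hne => h.ncard_inter hΓ hα h' hne⟩
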